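/- Let $G$ be a real Lie group (finite-dimensional, Hausdorff, second countable; not assumed connected) with identity element $e$ and Lie algebra $\mathfrak g = T_eG$, and let $\lambda$ be a right Haar measure on $G$, that is, a right-invariant Borel measure that is finite on compact sets and positive on nonempty open sets. Let $k\ge 0$ and let $X_1,\dots,X_k\in\mathfrak g$ be arbitrary. In particular the $X_j$ are not assumed to span $\mathfrak g$, nor to generate it as a Lie algebra. Let $\widetilde X_j$ be the left-invariant vector field on $G$ with $\widetilde X_j(e)=X_j$. Let $L$ be the unbounded operator on the complex Hilbert space $L^2(G,\lambda)$ with domain $\mathcal D(L)=C_c^\infty(G)$, the smooth compactly supported complex-valued functions on $G$ (identified with their classes in $L^2(G,\lambda)$), given by $$Lu=\sum_{j=1}^k \widetilde X_j\bigl(\widetilde X_j u\bigr),\qquad u\in C_c^\infty(G).$$ Then $L$ is essentially self-adjoint: $L$ is densely defined and closable, and its closure $\overline L$ is self-adjoint, $\overline L^{\,*}=\overline L$. -/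

import Mathlib

open scoped Manifold ContDiff
open MeasureTheory

noncomputable section

section EssentialSelfAdjointness

variable {𝓗 : Type*} [NormedAddCommGroup 𝓗] [InnerProductSpace ℂ 𝓗] [CompleteSpace 𝓗]

/-- An unbounded operator on a complex Hilbert space is essentially self-adjoint if it is densely
defined and closable, and its closure is self-adjoint. -/
def IsEssentiallySelfAdjoint (T : 𝓗 →ₗ.[ℂ] 𝓗) : Prop :=
  Dense (T.domain : Set 𝓗) ∧ T.IsClosable ∧ IsSelfAdjoint T.closure

end EssentialSelfAdjointness

section SumOfSquares

variable {E : Type*} [NormedAddCommGroup E] [NormedSpace ℝ E]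
  {H : Type*} [TopologicalSpace H] {I : ModelWithCorners ℝ E H}
  {G : Type*} [TopologicalSpace G] [ChartedSpace H G] [Group G]

/-- The derivative of a complex-valued function `u` on `G` along the left-invariant vector field
whose value at the identity is `v`. -/
def leftInvDeriv (v : GroupLieAlgebra I G) (u : G → ℂ) (g : G) : ℂ :=
  mvfderiv I u g (mulInvariantVectorField v g)

/-- The sum of squares `∑ j, X_j (X_j u)`, where `X_j` is the left-invariant vector field
determined by the Lie algebra element `X j`. -/
def sumOfSquares {k : ℕ} (X : Fin k → GroupLieAlgebra I G) (u : G → ℂ) (g : G) : ℂ :=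
  ∑ j, leftInvDeriv (X j) (leftInvDeriv (X j) u) g

variable (I G) in
/-- The space of smooth compactly supported complex-valued functions on `G`. -/
def smoothCompactlySupported : Submodule ℂ (G → ℂ) where
  carrier := {u | ContMDiff I 𝓘(ℝ, ℂ) ∞ u ∧ HasCompactSupport u}
  zero_mem' := ⟨contMDiff_const, HasCompactSupport.zero⟩
  add_mem' hu hv := ⟨hu.1.add hv.1, hu.2.add hv.2⟩
  smul_mem' c u hu :=
    ⟨(show ContDiff ℝ ∞ (fun z : ℂ ↦ c • z) by fun_prop).comp_contMDiff hu.1,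
      hu.2.smul_left (f := fun _ ↦ c)⟩

lemma leftInvDeriv_add (v : GroupLieAlgebra I G) {u w : G → ℂ}
    (hu : ContMDiff I 𝓘(ℝ, ℂ) ∞ u) (hw : ContMDiff I 𝓘(ℝ, ℂ) ∞ w) :
    leftInvDeriv v (u + w) = leftInvDeriv v u + leftInvDeriv v w := by
  funext g
  simp [leftInvDeriv, mvfderiv_add (hu.mdifferentiable (by simp) g)
    (hw.mdifferentiable (by simp) g)]

lemma leftInvDeriv_smul (v : GroupLieAlgebra I G) (c : ℂ) {u : G → ℂ}
    (hu : ContMDiff I 𝓘(ℝ, ℂ) ∞ u) :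
    leftInvDeriv v (c • u) = c • leftInvDeriv v u := by
  funext g
  have h1 : HasMFDerivAt I 𝓘(ℝ, ℂ) u g (mfderiv I 𝓘(ℝ, ℂ) u g) :=
    (hu.mdifferentiable (by simp) g).hasMFDerivAt
  have h2 : HasMFDerivAt 𝓘(ℝ, ℂ) 𝓘(ℝ, ℂ) (fun z : ℂ ↦ c • z) (u g)
      (c • ContinuousLinearMap.id ℝ ℂ) :=
    ((hasFDerivAt_id (𝕜 := ℝ) (u g)).const_smul c).hasMFDerivAt
  have h3 : mfderiv I 𝓘(ℝ, ℂ) (c • u) g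
      = (c • ContinuousLinearMap.id ℝ ℂ) ∘L mfderiv I 𝓘(ℝ, ℂ) u g :=
    (h2.comp g h1).mfderiv
  simp only [leftInvDeriv, mvfderiv, Pi.smul_apply]
  rw [h3]
  rfl

lemma hasCompactSupport_leftInvDeriv (v : GroupLieAlgebra I G) {u : G → ℂ}
    (hu : HasCompactSupport u) : HasCompactSupport (leftInvDeriv v u) := by
  refine hu.mono' fun g hg ↦ ?_
  by_contra hgu
  refine hg ?_
  have h : u =ᶠ[nhds g] fun _ ↦ 0 := notMem_tsupport_iff_eventuallyEq.1 hgu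
  simp only [leftInvDeriv, mvfderiv]
  rw [h.mfderiv_eq, mfderiv_const]
  rfl

lemma contMDiff_leftInvDeriv [LieGroup I ∞ G] (v : GroupLieAlgebra I G) {u : G → ℂ}
    (hu : ContMDiff I 𝓘(ℝ, ℂ) ∞ u) : ContMDiff I 𝓘(ℝ, ℂ) ∞ (leftInvDeriv v u) := by
  have h0 : IsManifold I ∞ G := inferInstance
  have : IsManifold I 1 G := IsManifold.of_le (n := ∞) (by simp)
  have : IsManifold I (∞ + 1) G := h0
  have hp : ContMDiff (I.prod I) 𝓘(ℝ, ℂ) ∞ (fun p : G × G ↦ u (p.1 * p.2)) :=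
    hu.comp (contMDiff_mul I ∞)
  let fg : G → TangentBundle I G := fun g ↦ Bundle.TotalSpace.mk' E g 0
  have sfg : ContMDiff I I.tangent ∞ fg := Bundle.contMDiff_zeroSection _ _
  let fv : G → TangentBundle I G := fun _ ↦ Bundle.TotalSpace.mk' E 1 v
  have sfv : ContMDiff I I.tangent ∞ fv := contMDiff_const
  have S₂ : ContMDiff (I.tangent.prod I.tangent) (I.prod I).tangent ∞
      (equivTangentBundleProd I G I G).symm := contMDiff_equivTangentBundleProd_symm
  have S₃ : ContMDiff (I.prod I).tangent 𝓘(ℝ, ℂ).tangent ∞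
      (tangentMap (I.prod I) 𝓘(ℝ, ℂ) (fun p : G × G ↦ u (p.1 * p.2))) :=
    hp.contMDiff_tangentMap (by simp)
  have S := (contMDiff_snd_tangentBundle_modelSpace ℂ 𝓘(ℝ, ℂ)).comp
    ((S₃.comp S₂).comp (sfg.prodMk sfv))
  have key : leftInvDeriv v u = fun g ↦ (tangentMap (I.prod I) 𝓘(ℝ, ℂ)
      (fun p : G × G ↦ u (p.1 * p.2)) ((equivTangentBundleProd I G I G).symm (fg g, fv g))).2 := by
    funext g
    have hd : MDifferentiableAt (I.prod I) 𝓘(ℝ, ℂ) (fun p : G × G ↦ u (p.1 * p.2)) (g, 1) :=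
      hp.mdifferentiable (by simp) (g, 1)
    have h1 : MDifferentiableAt I I (g * ·) (1 : G) :=
      (contMDiff_mul_left (I := I) (n := ∞)).mdifferentiable (by simp) 1
    have h2 : MDifferentiableAt I 𝓘(ℝ, ℂ) u (g * 1) := hu.mdifferentiable (by simp) _
    have h3 : mfderiv I 𝓘(ℝ, ℂ) (fun z : G ↦ u (g * z)) 1
        = (mfderiv I 𝓘(ℝ, ℂ) u (g * 1)) ∘L (mfderiv I I (g * ·) (1 : G)) := mfderiv_comp 1 h2 h1
    simp only [tangentMap, fg, fv]
    have h4 : (equivTangentBundleProd I G I G).symm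
        (Bundle.TotalSpace.mk' E g 0, Bundle.TotalSpace.mk' E 1 v)
        = (⟨(g, 1), ((0 : E), (v : E))⟩ : TangentBundle (I.prod I) (G × G)) := rfl
    rw [h4]
    refine Eq.trans ?_ (mfderiv_prod_eq_add_apply (E := E) (E' := E) (I := I) (I' := I) hd
      (v := ((0 : E), (id v : E)))).symm
    have h5 : mfderiv I 𝓘(ℝ, ℂ) (fun z : G ↦ u (z * 1)) g (0 : E) = (0 : ℂ) :=
      map_zero (mfderiv I 𝓘(ℝ, ℂ) (fun z : G ↦ u (z * 1)) g)
    have h6 : mfderiv I 𝓘(ℝ, ℂ) (fun z : G ↦ u (g * z)) 1 v = leftInvDeriv v u g := by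
      rw [h3, mul_one]
      rfl
    refine Eq.trans ?_ (congrArg₂ (fun a b : ℂ ↦ a + b) h5 h6).symm
    exact (zero_add _).symm
  rw [key]
  exact S

/-- The sum of squares as a linear endomorphism of the smooth compactly supported functions. -/
def sumOfSquaresTest [LieGroup I ∞ G] {k : ℕ} (X : Fin k → GroupLieAlgebra I G) :
    smoothCompactlySupported I G →ₗ[ℂ] smoothCompactlySupported I G where
  toFun u := ⟨sumOfSquares X u, by
    have h : sumOfSquares X u = ∑ j, leftInvDeriv (X j) (leftInvDeriv (X j) u) := by
      funext g
      simp [sumOfSquares]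
    rw [h]
    exact Submodule.sum_mem _ fun j _ ↦
      ⟨contMDiff_leftInvDeriv _ (contMDiff_leftInvDeriv _ u.2.1),
        hasCompactSupport_leftInvDeriv _ (hasCompactSupport_leftInvDeriv _ u.2.2)⟩⟩
  map_add' u w := by
    ext g
    simp [sumOfSquares, leftInvDeriv_add _ u.2.1 w.2.1,
      leftInvDeriv_add _ (contMDiff_leftInvDeriv _ u.2.1) (contMDiff_leftInvDeriv _ w.2.1),
      Finset.sum_add_distrib]
  map_smul' c u := by
    ext g
    simp [sumOfSquares, leftInvDeriv_smul _ c u.2.1,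
      leftInvDeriv_smul _ c (contMDiff_leftInvDeriv _ u.2.1), Finset.mul_sum]

variable [MeasurableSpace G] [BorelSpace G]

set_option linter.unusedSectionVars false in
lemma memLp_smoothCompactlySupported (mu : Measure G) [IsFiniteMeasureOnCompacts mu]
    (u : smoothCompactlySupported I G) : MemLp (u : G → ℂ) 2 mu :=
  u.2.1.continuous.memLp_of_hasCompactSupport u.2.2

variable (I) in
/-- The map sending a smooth compactly supported function to its class in `L²`. -/
def testToL2 (mu : Measure G) [IsFiniteMeasureOnCompacts mu] :
    smoothCompactlySupported I G →ₗ[ℂ] Lp ℂ 2 mu where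
  toFun u := (memLp_smoothCompactlySupported mu u).toLp u
  map_add' _ _ := rfl
  map_smul' _ _ := rfl

lemma testToL2_injective (mu : Measure G) [IsFiniteMeasureOnCompacts mu] [mu.IsOpenPosMeasure] :
    Function.Injective (testToL2 I mu) := by
  intro u w h
  have h' := (MemLp.toLp_eq_toLp_iff (memLp_smoothCompactlySupported mu u)
    (memLp_smoothCompactlySupported mu w)).1 h
  exact Subtype.ext (u.2.1.continuous.ae_eq_iff_eq mu w.2.1.continuous |>.1 h')

/-- The sum of squares as an unbounded operator on `L²`, whose domain is the space of (classes of)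
smooth compactly supported functions. -/
def sumOfSquaresL2 [LieGroup I ∞ G] {k : ℕ} (X : Fin k → GroupLieAlgebra I G)
    (mu : Measure G) [IsFiniteMeasureOnCompacts mu] [mu.IsOpenPosMeasure] :
    Lp ℂ 2 mu →ₗ.[ℂ] Lp ℂ 2 mu where
  domain := LinearMap.range (testToL2 I mu)
  toFun := testToL2 I mu ∘ₗ sumOfSquaresTest X ∘ₗ
    (LinearEquiv.ofInjective (testToL2 I mu) (testToL2_injective mu)).symm.toLinearMap

end SumOfSquares

end

/-!
Write `L = ∑ j, X_j X_j`. Right invariance of the measure makes every left-invariant vector field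
skew-symmetric on test functions, so `L` is symmetric and nonpositive. For such an operator essential
self-adjointness follows once `1 - L` has dense range (`isEssentiallySelfAdjoint_of_nonpos`), that is,
once a square-integrable `f` with `∫ f (u - L u) = 0` for all test functions `u` must vanish.

No hypoellipticity is available, since the `X_j` need not generate the Lie algebra. Smoothness comes
from mollifying by *left* translations instead, because these commute with left-invariant vector
fields. The function `w g = ∫ f h * φ (h * g⁻¹)` is smooth, and `∫ w (u - L u) = 0` still holds for all
test functions `u`, because moving the mollification onto `u` produces another test function
(`integral_mollify_mul`, `sumOfSquares_leftAverage`). Left translation multiplies a right Haar measure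
by a constant that is bounded on compact sets, so `w` is again square-integrable
(`lintegral_enorm_mollify_sq_lt_top`).

For smooth `w`, testing with `χ ^ 2 * conj w` gives the energy estimate
`∫ |χ w|² ≤ ∑ j, ∫ |X_j χ|² |w|²` (`integral_cutoff_sq_le`). Cutoffs `χ` with uniformly bounded
derivatives are obtained by averaging the left translates `g ↦ ψ (y * g)` of a test function `ψ` of
integral one over the sets `K_n` of a compact exhaustion. Then `χ_n → ∫ ψ = 1` and
`X_j χ_n → ∫ X_j ψ = 0`, both boundedly (`exists_cutoff`). Dominated convergence gives `w = 0`, and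
evaluating `w` at the identity gives `∫ f φ = 0` for every test function `φ`, hence `f = 0`.
-/

noncomputable section

/-! ### A criterion for essential self-adjointness -/

section SelfAdjointnessCriterion

open scoped InnerProductSpace

variable {𝓗 : Type*} [NormedAddCommGroup 𝓗] [InnerProductSpace ℂ 𝓗] [CompleteSpace 𝓗]

omit [CompleteSpace 𝓗] in
lemma norm_le_norm_sub_apply_of_nonpos {T : 𝓗 →ₗ.[ℂ] 𝓗}
    (hneg : ∀ x : T.domain, (⟪T x, (x : 𝓗)⟫_ℂ).re ≤ 0)
    (x : T.domain) : ‖(x : 𝓗)‖ ≤ ‖(x : 𝓗) - T x‖ := by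
  have h1 : ‖(x : 𝓗)‖ ^ 2 ≤ ‖(x : 𝓗) - T x‖ * ‖(x : 𝓗)‖ := by
    calc ‖(x : 𝓗)‖ ^ 2 ≤ (⟪(x : 𝓗) - T x, (x : 𝓗)⟫_ℂ).re := by
          rw [inner_sub_left, Complex.sub_re]
          have := hneg x
          have h2 : (⟪(x : 𝓗), (x : 𝓗)⟫_ℂ).re = ‖(x : 𝓗)‖ ^ 2 :=
            (norm_sq_eq_re_inner (𝕜 := ℂ) (x : 𝓗)).symm
          linarith
      _ ≤ _ := (Complex.re_le_norm _).trans (norm_inner_le_norm _ _)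
  rcases (norm_nonneg (x : 𝓗)).eq_or_lt with h | h
  · rw [← h]; exact norm_nonneg _
  · nlinarith

/-- A densely defined, symmetric, nonpositive operator `T` such that `1 - T` has dense range is
essentially self-adjoint: given `(y, z)` in the graph of the adjoint, approximate `y - z` by elements
of the range of `1 - T`. Nonpositivity makes the preimages converge, and their limit differs from `y`
by a vector orthogonal to the range of `1 - T`. -/
theorem isEssentiallySelfAdjoint_of_nonpos {T : 𝓗 →ₗ.[ℂ] 𝓗} (hd : Dense (T.domain : Set 𝓗))
    (hs : T.IsFormalAdjoint T) (hneg : ∀ x : T.domain, (⟪T x, (x : 𝓗)⟫_ℂ).re ≤ 0)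
    (hker : ∀ y : 𝓗, (∀ x : T.domain, ⟪y, (x : 𝓗) - T x⟫_ℂ = 0) → y = 0) :
    IsEssentiallySelfAdjoint T := by
  have hle : T ≤ T.adjoint := hs.le_adjoint hd
  have hcl : T.adjoint.IsClosed := LinearPMap.adjoint_isClosed hd
  have hclosable : T.IsClosable := hcl.isClosable.leIsClosable hle
  have hgr : T.graph ≤ T.adjoint.graph := LinearPMap.le_graph_of_le hle
  have hgr' : T.graph.topologicalClosure ≤ T.adjoint.graph :=
    Submodule.topologicalClosure_minimal _ hgr hcl
  -- The range of `1 - T` is dense.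
  let R : Submodule ℂ 𝓗 := LinearMap.range (T.domain.subtype - T.toFun)
  have hR : R.topologicalClosure = ⊤ := by
    rw [Submodule.topologicalClosure_eq_top_iff, Submodule.eq_bot_iff]
    intro y hy
    refine hker y fun x ↦ ?_
    exact (Submodule.mem_orthogonal' R y).1 hy _ ⟨x, rfl⟩
  have hRd (z : 𝓗) : z ∈ closure (R : Set 𝓗) := by
    have : z ∈ R.topologicalClosure := hR ▸ Submodule.mem_top
    exact this
  have hadj (p : 𝓗 × 𝓗) : p ∈ T.adjoint.graph ↔
      ∀ x : T.domain, ⟪T x, p.1⟫_ℂ - ⟪(x : 𝓗), p.2⟫_ℂ = 0 := by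
    rw [LinearPMap.adjoint_graph_eq_graph_adjoint hd, Submodule.mem_adjoint_iff]
    constructor
    · intro h x
      exact h _ _ (T.mem_graph x)
    · intro h a b hab
      obtain ⟨x, rfl, rfl⟩ := (LinearPMap.mem_graph_iff T).1 hab
      exact h x
  have hge : T.adjoint.graph ≤ T.graph.topologicalClosure := by
    rintro ⟨y, z⟩ hyz
    obtain ⟨a, ha, hlim⟩ := mem_closure_iff_seq_limit.1 (hRd (y - z))
    choose x hx using ha
    have hx' (n : ℕ) : (x n : 𝓗) - T (x n) = a n := hx n
    have hcauchy : CauchySeq fun n ↦ (x n : 𝓗) := by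
      rw [Metric.cauchySeq_iff]
      intro ε hε
      obtain ⟨N, hN⟩ := Metric.cauchySeq_iff.1 hlim.cauchySeq ε hε
      refine ⟨N, fun m hm n hn ↦ lt_of_le_of_lt ?_ (hN m hm n hn)⟩
      rw [dist_eq_norm, dist_eq_norm, ← hx' m, ← hx' n]
      have h := norm_le_norm_sub_apply_of_nonpos hneg (x m - x n)
      rw [LinearPMap.map_sub, Submodule.coe_sub, sub_sub_sub_comm] at h
      exact h
    obtain ⟨x₀, hx₀⟩ := cauchySeq_tendsto_of_complete hcauchy
    have hT : Filter.Tendsto (fun n ↦ T (x n)) Filter.atTop (nhds (x₀ - (y - z))) := by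
      refine (hx₀.sub hlim).congr fun n ↦ ?_
      rw [← hx' n]; abel
    have hmem : (x₀, x₀ - (y - z)) ∈ T.graph.topologicalClosure :=
      mem_closure_of_tendsto (hx₀.prodMk_nhds hT) (.of_forall fun n ↦ T.mem_graph (x n))
    -- The difference `y - x₀` is fixed by the adjoint, so it is orthogonal to the range of `1 - T`.
    have hdiff := T.adjoint.graph.sub_mem hyz (hgr' hmem)
    have h0 : y - x₀ = 0 := by
      refine hker _ fun u ↦ ?_
      have h := (hadj _).1 hdiff u
      have e : z - (x₀ - (y - z)) = y - x₀ := by abel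
      simp only [Prod.mk_sub_mk, e] at h
      rw [← inner_conj_symm, inner_sub_left, ← neg_sub, h]
      simp
    have hy : y = x₀ := sub_eq_zero.1 h0
    subst hy
    simpa using hmem
  have hgreq : T.closure.graph = T.adjoint.graph := by
    rw [← hclosable.graph_closure_eq_closure_graph]
    exact le_antisymm hgr' hge
  have hceq : T.closure = T.adjoint := LinearPMap.eq_of_eq_graph hgreq
  refine ⟨hd, hclosable, ?_⟩
  rw [LinearPMap.isSelfAdjoint_def]
  have hd' : Dense (T.closure.domain : Set 𝓗) := hd.mono T.le_closure.1
  apply LinearPMap.eq_of_eq_graph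
  -- The adjoint only depends on the closure of the graph.
  nth_rw 2 [hceq]
  ext p
  rw [hadj, LinearPMap.adjoint_graph_eq_graph_adjoint hd', Submodule.mem_adjoint_iff]
  constructor
  · intro h x
    exact h _ _ (LinearPMap.le_graph_of_le T.le_closure (T.mem_graph x))
  · intro h a b hab
    rw [← hclosable.graph_closure_eq_closure_graph] at hab
    have hclosed : IsClosed {q : 𝓗 × 𝓗 | ⟪q.2, p.1⟫_ℂ - ⟪q.1, p.2⟫_ℂ = 0} :=
      isClosed_eq (by fun_prop) continuous_const
    refine closure_minimal (fun q hq ↦ ?_) hclosed hab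
    obtain ⟨x, hx1, hx2⟩ := (LinearPMap.mem_graph_iff T).1 hq
    simpa [← hx1, ← hx2] using h x

end SelfAdjointnessCriterion

/-! ### Smoothness of integrals depending on a parameter -/

section ParametricIntegral

lemma norm_smul_le_of_norm_le_indicator {M F : Type*} [NormedAddCommGroup F] [NormedSpace ℂ F]
    {D : Set M} {f : M → ℂ} {y : F} {h : M} {C : ℝ} (hy : ‖y‖ ≤ D.indicator (fun _ ↦ C) h) :
    ‖f h • y‖ ≤ ‖D.indicator f h‖ * C := by
  rw [norm_smul]
  by_cases hh : h ∈ D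
  · simp only [hh, Set.indicator_of_mem] at hy ⊢
    gcongr
  · simp only [hh, not_false_eq_true, Set.indicator_of_notMem] at hy ⊢
    have : ‖y‖ = 0 := le_antisymm hy (norm_nonneg _)
    simp [this]

variable {E : Type*} [NormedAddCommGroup E] [NormedSpace ℝ E] [FiniteDimensional ℝ E]
  {H : Type*} [TopologicalSpace H] {I : ModelWithCorners ℝ E H}
  {M : Type*} [TopologicalSpace M] [ChartedSpace H M] [IsManifold I ∞ M]
  [MeasurableSpace M] [BorelSpace M] [SecondCountableTopology M]

omit [FiniteDimensional ℝ E] [MeasurableSpace M] [BorelSpace M] [SecondCountableTopology M] in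
lemma contMDiffAt_fderiv_param {F : Type*} [NormedAddCommGroup F] [NormedSpace ℝ F]
    {k : F → M → ℂ} {x : F} {h : M}
    (hk : ContMDiffAt (𝓘(ℝ, F).prod I) 𝓘(ℝ, ℂ) ∞ (fun p : F × M ↦ k p.1 p.2) (x, h)) :
    ContMDiffAt (𝓘(ℝ, F).prod I) 𝓘(ℝ, F →L[ℝ] ℂ) ∞
      (fun p : F × M ↦ fderiv ℝ (fun y ↦ k y p.2) p.1) (x, h) := by
  have h1 : ContMDiffAt ((𝓘(ℝ, F).prod I).prod 𝓘(ℝ, F)) 𝓘(ℝ, ℂ) ∞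
      (Function.uncurry fun (p : F × M) (y : F) ↦ k y p.2) ((x, h), x) :=
    ContMDiffAt.comp ((x, h), x) (f := fun q : (F × M) × F ↦ (q.2, q.1.2))
      (g := fun p : F × M ↦ k p.1 p.2) hk
      (contMDiffAt_snd.prodMk (contMDiffAt_snd.comp _ contMDiffAt_fst))
  have h2 := ContMDiffAt.mfderiv (m := ∞) (n := ∞) (fun (p : F × M) (y : F) ↦ k y p.2)
    (fun p : F × M ↦ p.1) h1 contMDiffAt_fst (by simp)
  simpa [inTangentCoordinates_model_space, mfderiv_eq_fderiv] using h2

omit [MeasurableSpace M] [BorelSpace M] [SecondCountableTopology M] in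
lemma exists_nhds_norm_le_indicator {F : Type*} [NormedAddCommGroup F] {Φ : E → M → F} {U : Set E}
    (hU : IsOpen U) {D : Set M} (hD : IsCompact D)
    (hΦ : ∀ x ∈ U, ∀ h, ContinuousAt (fun p : E × M ↦ Φ p.1 p.2) (x, h))
    (hΦ0 : ∀ x ∈ U, ∀ h ∉ D, Φ x h = 0) {x₀ : E} (hx₀ : x₀ ∈ U) :
    ∃ s ∈ nhds x₀, s ⊆ U ∧ ∃ C, ∀ x ∈ s, ∀ h, ‖Φ x h‖ ≤ D.indicator (fun _ ↦ C) h := by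
  obtain ⟨s, hs, hsU, hsc⟩ := local_compact_nhds (hU.mem_nhds hx₀)
  obtain ⟨C, hC⟩ := (hsc.prod hD).exists_bound_of_continuousOn
    (f := fun p : E × M ↦ Φ p.1 p.2) fun p hp ↦ (hΦ p.1 (hsU hp.1) p.2).continuousWithinAt
  refine ⟨s, hs, hsU, C, fun x hx h ↦ ?_⟩
  by_cases hh : h ∈ D
  · simpa [hh] using hC (x, h) ⟨hx, hh⟩
  · simp [hh, hΦ0 x (hsU hx) h hh]

lemma MeasureTheory.LocallyIntegrable.aestronglyMeasurable_smul {F : Type*}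
    [NormedAddCommGroup F] [NormedSpace ℂ F] {μ : Measure M} {f : M → ℂ}
    (hf : LocallyIntegrable f μ) {φ : M → F} (hφ : Continuous φ) :
    AEStronglyMeasurable (fun h ↦ f h • φ h) μ :=
  hf.aestronglyMeasurable.smul hφ.aestronglyMeasurable

/-- Differentiation under the integral sign, over a vector space of parameters. Only derivatives in
fixed directions enter the induction, so the kernels stay complex-valued. -/
lemma contDiffOn_integral_mul {μ : Measure M} {f : M → ℂ} (hf : LocallyIntegrable f μ)
    {U : Set E} (hU : IsOpen U) {D : Set M} (hD : IsCompact D) (hDm : MeasurableSet D) (n : ℕ)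
    {k : E → M → ℂ}
    (hk : ∀ x ∈ U, ∀ h, ContMDiffAt (𝓘(ℝ, E).prod I) 𝓘(ℝ, ℂ) ∞ (fun p : E × M ↦ k p.1 p.2) (x, h))
    (hk0 : ∀ x ∈ U, ∀ h ∉ D, k x h = 0) :
    ContDiffOn ℝ n (fun x ↦ ∫ h, f h * k x h ∂μ) U := by
  have hfD : Integrable (D.indicator f) μ :=
    (integrable_indicator_iff hDm).2 (hf.integrableOn_isCompact hD)
  induction n generalizing k with
  | zero =>
    have hcont : ∀ x ∈ U, ∀ h, ContinuousAt (fun p : E × M ↦ k p.1 p.2) (x, h) :=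
      fun x hx h ↦ (hk x hx h).continuousAt
    refine contDiffOn_zero.2 fun x₀ hx₀ ↦ ContinuousAt.continuousWithinAt ?_
    obtain ⟨s, hs, hsU, C, hC⟩ := exists_nhds_norm_le_indicator hU hD hcont hk0 hx₀
    refine continuousAt_of_dominated (bound := fun h ↦ ‖D.indicator f h‖ * C) ?_ ?_
      (hfD.norm.mul_const C) (.of_forall fun h ↦ ?_)
    · filter_upwards [hs] with x hx
      exact hf.aestronglyMeasurable_smul (continuous_iff_continuousAt.2 fun h ↦
        (hcont x (hsU hx) h).comp (f := fun h ↦ (x, h)) (by fun_prop))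
    · filter_upwards [hs] with x hx using .of_forall fun h ↦
        norm_smul_le_of_norm_le_indicator (hC x hx h)
    · exact continuousAt_const.mul ((hcont x₀ hx₀ h).comp (f := fun x ↦ (x, h)) (by fun_prop))
  | succ n ih =>
    let k' : E → M → E →L[ℝ] ℂ := fun x h ↦ fderiv ℝ (fun y ↦ k y h) x
    have hk' : ∀ x ∈ U, ∀ h, ContMDiffAt (𝓘(ℝ, E).prod I) 𝓘(ℝ, E →L[ℝ] ℂ) ∞
        (fun p : E × M ↦ k' p.1 p.2) (x, h) := fun x hx h ↦ contMDiffAt_fderiv_param (hk x hx h)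
    have hcont : ∀ x ∈ U, Continuous (k x) := fun x hx ↦ continuous_iff_continuousAt.2 fun h ↦
      (hk x hx h).continuousAt.comp (f := fun h ↦ (x, h)) (by fun_prop)
    have hcont' : ∀ x ∈ U, Continuous (k' x) := fun x hx ↦ continuous_iff_continuousAt.2 fun h ↦
      (hk' x hx h).continuousAt.comp (f := fun h ↦ (x, h)) (by fun_prop)
    have hk0' : ∀ x ∈ U, ∀ h ∉ D, k' x h = 0 := by
      intro x hx h hh
      have : (fun y ↦ k y h) =ᶠ[nhds x] fun _ ↦ 0 := by
        filter_upwards [hU.mem_nhds hx] with y hy using hk0 y hy h hh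
      simp only [k']
      rw [this.fderiv_eq]; simp
    have hkd : ∀ x ∈ U, ∀ h, DifferentiableAt ℝ (fun y ↦ k y h) x := fun x hx h ↦ by
      have : ContMDiffAt 𝓘(ℝ, E) 𝓘(ℝ, ℂ) ∞ (fun y ↦ k y h) x :=
        (hk x hx h).comp x (contMDiffAt_id.prodMk contMDiffAt_const)
      exact this.contDiffAt.differentiableAt (by simp)
    have hder : ∀ x ∈ U, Integrable (fun h ↦ f h • k' x h) μ ∧
        HasFDerivAt (fun x ↦ ∫ h, f h * k x h ∂μ) (∫ h, f h • k' x h ∂μ) x := by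
      intro x hx
      obtain ⟨s, hs, hsU, C, hC⟩ := exists_nhds_norm_le_indicator hU hD
        (fun x hx h ↦ (hk x hx h).continuousAt) hk0 hx
      obtain ⟨s', hs', hsU', C', hC'⟩ := exists_nhds_norm_le_indicator hU hD
        (fun x hx h ↦ (hk' x hx h).continuousAt) hk0' hx
      refine ⟨(hfD.norm.mul_const C').mono' (hf.aestronglyMeasurable_smul (hcont' x hx))
        (.of_forall fun h ↦ norm_smul_le_of_norm_le_indicator (hC' x (mem_of_mem_nhds hs') h)), ?_⟩
      refine hasFDerivAt_integral_of_dominated_of_fderiv_le hs'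
        (F' := fun x h ↦ f h • k' x h)
        (bound := fun h ↦ ‖D.indicator f h‖ * C') ?_ ?_ (hf.aestronglyMeasurable_smul (hcont' x hx)) ?_
        (hfD.norm.mul_const C') ?_
      · filter_upwards [hU.mem_nhds hx] with y hy using hf.aestronglyMeasurable_smul (hcont y hy)
      · exact (hfD.norm.mul_const C).mono' (hf.aestronglyMeasurable_smul (hcont x hx))
          (.of_forall fun h ↦ norm_smul_le_of_norm_le_indicator (hC x (mem_of_mem_nhds hs) h))
      · exact .of_forall fun h y hy ↦ norm_smul_le_of_norm_le_indicator (hC' y hy h)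
      · exact .of_forall fun h y hy ↦ ((hkd y (hsU' hy) h).hasFDerivAt.const_smul (f h))
    push_cast
    rw [contDiffOn_succ_iff_fderiv_apply hU.uniqueDiffOn]
    refine ⟨fun x hx ↦ (hder x hx).2.differentiableAt.differentiableWithinAt, by simp, fun y ↦ ?_⟩
    refine (ih (k := fun x h ↦ k' x h y) (fun x hx h ↦ ?_) fun x hx h hh ↦ ?_).congr fun x hx ↦ ?_
    · exact (hk' x hx h).clm_apply contMDiffAt_const
    · simp [hk0' x hx h hh]
    · rw [fderivWithin_of_isOpen hU hx, (hder x hx).2.fderiv,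
        ContinuousLinearMap.integral_apply (hder x hx).1]
      rfl

/-- Smoothness of a parametrised integral: the kernel is smooth in both variables, and locally in
the parameter it is supported in a fixed compact set of the integration variable. -/
theorem contMDiff_integral_mul [T2Space M] [I.Boundaryless] {μ : Measure M} {f : M → ℂ}
    (hf : LocallyIntegrable f μ) {K : M → M → ℂ}
    (hK : ContMDiff (I.prod I) 𝓘(ℝ, ℂ) ∞ (fun p : M × M ↦ K p.1 p.2))
    (hK0 : ∀ g₀, ∃ D : Set M, IsCompact D ∧ ∀ᶠ g in nhds g₀, ∀ h ∉ D, K g h = 0) :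
    ContMDiff I 𝓘(ℝ, ℂ) ∞ (fun g ↦ ∫ h, f h * K g h ∂μ) := by
  intro g₀
  obtain ⟨D, hD, hev⟩ := hK0 g₀
  obtain ⟨W, hW, hWo, hgW⟩ := eventually_nhds_iff.1 hev
  set e := extChartAt I g₀ with he
  let U : Set E := e.target ∩ e.symm ⁻¹' W
  have hU : IsOpen U := (continuousOn_extChartAt_symm g₀).isOpen_inter_preimage
    (isOpen_extChartAt_target g₀) hWo
  have hsm : ∀ x ∈ U, ∀ h, ContMDiffAt (𝓘(ℝ, E).prod I) 𝓘(ℝ, ℂ) ∞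
      (fun p : E × M ↦ K (e.symm p.1) p.2) (x, h) := by
    intro x hx h
    have h1 : ContMDiffAt 𝓘(ℝ, E) I ∞ e.symm x :=
      (contMDiffOn_extChartAt_symm g₀).contMDiffAt ((isOpen_extChartAt_target g₀).mem_nhds hx.1)
    exact ContMDiffAt.comp (x, h) (f := fun p : E × M ↦ (e.symm p.1, p.2))
      (g := fun p : M × M ↦ K p.1 p.2) (hK _)
      ((ContMDiffAt.comp (x, h) (f := Prod.fst) h1 contMDiffAt_fst).prodMk contMDiffAt_snd)
  have key : ContDiffOn ℝ ∞ (fun x ↦ ∫ h, f h * K (e.symm x) h ∂μ) U := by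
    rw [contDiffOn_infty]
    exact fun n ↦ contDiffOn_integral_mul hf hU hD hD.measurableSet n hsm
      fun x hx h hh ↦ hW _ hx.2 h hh
  have hgU : e g₀ ∈ U := ⟨mem_extChartAt_target g₀, by simpa [he] using hgW⟩
  have h2 : ContMDiffAt I 𝓘(ℝ, ℂ) ∞ (fun g ↦ ∫ h, f h * K (e.symm (e g)) h ∂μ) g₀ :=
    ContMDiffAt.comp g₀ (f := e) (key.contDiffAt (hU.mem_nhds hgU)).contMDiffAt
      contMDiffAt_extChartAt
  refine h2.congr_of_eventuallyEq ?_
  filter_upwards [extChartAt_source_mem_nhds (I := I) g₀] with g hg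
  rw [e.left_inv hg]

end ParametricIntegral

/-! ### Differentiation along left-invariant vector fields -/

section LeftInvariantDerivative

variable {E : Type*} [NormedAddCommGroup E] [NormedSpace ℝ E]
  {H : Type*} [TopologicalSpace H] {I : ModelWithCorners ℝ E H}
  {G : Type*} [TopologicalSpace G] [ChartedSpace H G] [Group G]

lemma leftInvDeriv_congr {v : GroupLieAlgebra I G} {u w : G → ℂ} {g : G}
    (h : u =ᶠ[nhds g] w) : leftInvDeriv v u g = leftInvDeriv v w g := by
  simp only [leftInvDeriv, mvfderiv]
  rw [h.mfderiv_eq, h.eq_of_nhds]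

lemma leftInvDeriv_const (v : GroupLieAlgebra I G) (c : ℂ) (g : G) :
    leftInvDeriv v (fun _ ↦ c) g = 0 := by
  simp only [leftInvDeriv, mvfderiv, mfderiv_const]
  rfl

omit [Group G] in
lemma contMDiff_mul_complex {u w : G → ℂ} (hu : ContMDiff I 𝓘(ℝ, ℂ) ∞ u)
    (hw : ContMDiff I 𝓘(ℝ, ℂ) ∞ w) : ContMDiff I 𝓘(ℝ, ℂ) ∞ (fun g ↦ u g * w g) :=
  (show ContDiff ℝ ∞ (fun p : ℂ × ℂ ↦ p.1 * p.2) by fun_prop).comp_contMDiff (hu.prodMk_space hw)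

lemma leftInvDeriv_mul (v : GroupLieAlgebra I G) {u w : G → ℂ}
    (hu : ContMDiff I 𝓘(ℝ, ℂ) ∞ u) (hw : ContMDiff I 𝓘(ℝ, ℂ) ∞ w) (g : G) :
    leftInvDeriv v (fun g ↦ u g * w g) g = leftInvDeriv v u g * w g + u g * leftInvDeriv v w g := by
  have h1 : HasMFDerivAt I 𝓘(ℝ, ℂ) u g (mfderiv I 𝓘(ℝ, ℂ) u g) :=
    (hu.mdifferentiable (by simp) g).hasMFDerivAt
  have h2 : HasMFDerivAt I 𝓘(ℝ, ℂ) w g (mfderiv I 𝓘(ℝ, ℂ) w g) :=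
    (hw.mdifferentiable (by simp) g).hasMFDerivAt
  have h3 := (h1.mul h2).mfderiv
  simp only [leftInvDeriv, mvfderiv]
  have : (fun g ↦ u g * w g) = u * w := rfl
  rw [this, h3]
  change u g * _ + w g * _ = _
  simp only [mfderiv]
  ring_nf
  rfl

lemma leftInvDeriv_conj (v : GroupLieAlgebra I G) {u : G → ℂ}
    (hu : ContMDiff I 𝓘(ℝ, ℂ) ∞ u) (g : G) :
    leftInvDeriv v (fun g ↦ star (u g)) g = star (leftInvDeriv v u g) := by
  have h1 : HasMFDerivAt I 𝓘(ℝ, ℂ) u g (mfderiv I 𝓘(ℝ, ℂ) u g) :=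
    (hu.mdifferentiable (by simp) g).hasMFDerivAt
  have h2 : HasMFDerivAt 𝓘(ℝ, ℂ) 𝓘(ℝ, ℂ) (fun z : ℂ ↦ star z) (u g)
      (Complex.conjCLE : ℂ →L[ℝ] ℂ) :=
    (Complex.conjCLE.hasFDerivAt (x := u g)).hasMFDerivAt
  have h3 := (h2.comp g h1).mfderiv
  simp only [leftInvDeriv, mvfderiv]
  have : (fun g ↦ star (u g)) = (fun z : ℂ ↦ star z) ∘ u := rfl
  rw [this, h3]
  rfl

variable [LieGroup I ∞ G]

lemma mfderiv_mul_left_mulInvariantVectorField (v : GroupLieAlgebra I G) (h g : G) :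
    mfderiv I I (h * ·) g (mulInvariantVectorField v g) = mulInvariantVectorField v (h * g) := by
  have hd (a b : G) : MDifferentiableAt I I (a * ·) b :=
    (contMDiff_mul_left (I := I) (n := ∞)).mdifferentiable (by simp) b
  have h1 : ((h * g) * · : G → G) = (h * ·) ∘ (g * ·) := by ext x; simp [mul_assoc]
  simp only [mulInvariantVectorField]
  rw [h1, mfderiv_comp (I' := I) 1 (hd _ _) (hd _ _)]
  have h2 : ∀ x, x = g → (mfderiv I I (h * ·) g : E →L[ℝ] E) = mfderiv I I (h * ·) x := by
    rintro x rfl; rfl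
  exact congrArg (fun L : E →L[ℝ] E ↦ L (mfderiv I I (g * ·) (1 : G) v)) (h2 _ (mul_one g))

/-- An integral curve `γ` through the identity of the left-invariant vector field defined by `v`. Its
left translates are integral curves as well, so differentiating any smooth function along them gives
its left-invariant derivative. -/
lemma exists_curve_hasDerivAt [CompleteSpace E] [I.Boundaryless] [T2Space G]
    (v : GroupLieAlgebra I G) :
    ∃ ε > 0, ∃ γ : ℝ → G, γ 0 = 1 ∧ ContinuousOn γ (Set.Icc (-ε) ε) ∧
      ∀ u : G → ℂ, ContMDiff I 𝓘(ℝ, ℂ) ∞ u → ∀ h, ∀ t ∈ Set.Icc (-ε) ε,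
        HasDerivAt (fun s ↦ u (h * γ s)) (leftInvDeriv v u (h * γ t)) t := by
  have : LieGroup I (minSmoothness ℝ 3) G := LieGroup.of_le (n := ∞)
    (by simpa using ENat.LEInfty.out)
  have : IsManifold I 1 G := IsManifold.of_le (n := ∞) (by simp)
  have hv := (contMDiff_mulInvariantVectorField (I := I) (G := G) v).of_le
    (m := 1) (by simp)
  obtain ⟨γ, hγ0, hγ⟩ := exists_isMIntegralCurveAt_of_contMDiffAt_boundaryless (I := I) (t₀ := 0)
    (hv 1)
  obtain ⟨ε, hε, hball⟩ := Metric.eventually_nhds_iff_ball.1 hγ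
  have hI : ∀ t ∈ Set.Icc (-(ε / 2)) (ε / 2), t ∈ Metric.ball (0 : ℝ) ε := fun t ht ↦ by
    rw [Real.ball_eq_Ioo]; constructor <;> linarith [ht.1, ht.2]
  refine ⟨ε / 2, by positivity, γ, hγ0, fun t ht ↦
    (hball t (hI t ht)).continuousAt.continuousWithinAt, fun u hu h t ht ↦ ?_⟩
  have h1 := hball t (hI t ht)
  have h2 : HasMFDerivAt I I (h * ·) (γ t) (mfderiv I I (h * ·) (γ t)) :=
    ((contMDiff_mul_left (I := I) (n := ∞)).mdifferentiable (by simp) _).hasMFDerivAt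
  have h3 : HasMFDerivAt I 𝓘(ℝ, ℂ) u (h * γ t) (mfderiv I 𝓘(ℝ, ℂ) u (h * γ t)) :=
    (hu.mdifferentiable (by simp) _).hasMFDerivAt
  have h4 : HasMFDerivAt 𝓘(ℝ, ℝ) 𝓘(ℝ, ℂ) (fun s ↦ u (h * γ s)) t _ := h3.comp t (h2.comp t h1)
  have h5 := (hasMFDerivAt_iff_hasFDerivAt.1 h4)
  obtain ⟨D, hD, hD1⟩ : ∃ D : ℝ →L[ℝ] ℂ, HasFDerivAt (fun s ↦ u (h * γ s)) D t ∧
      D 1 = leftInvDeriv v u (h * γ t) := by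
    refine ⟨_, h5, ?_⟩
    simp only [leftInvDeriv, mvfderiv, ← mfderiv_mul_left_mulInvariantVectorField v h (γ t)]
    change mfderiv I 𝓘(ℝ, ℂ) u (h * γ t) (mfderiv I I (h * ·) (γ t)
    ((1 : ℝ) • mulInvariantVectorField v (γ t))) = _
    rw [one_smul]
    rfl
  rw [← hD1]
  exact hD.hasDerivAt

end LeftInvariantDerivative

/-! ### Averages of left translates and integration by parts -/

section LeftAverage

open scoped Pointwise

variable {G : Type*} [Group G] [MeasurableSpace G]

/-- The average `g ↦ ∫ f(y) u(y g) dμ(y)` of the left translates of `u` with weight `f`. -/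
def leftAverage (μ : Measure G) (f u : G → ℂ) (g : G) : ℂ := ∫ y, f y * u (y * g) ∂μ

variable {E : Type*} [NormedAddCommGroup E] [NormedSpace ℝ E]
  {H : Type*} [TopologicalSpace H] {I : ModelWithCorners ℝ E H}
  [TopologicalSpace G] [ChartedSpace H G]

omit [MeasurableSpace G] in
lemma leftInvDeriv_eq_zero_of_notMem_tsupport (v : GroupLieAlgebra I G) {u : G → ℂ} {g : G}
    (hg : g ∉ tsupport u) : leftInvDeriv v u g = 0 := by
  rw [leftInvDeriv_congr (notMem_tsupport_iff_eventuallyEq.1 hg)]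
  exact leftInvDeriv_const v 0 g

variable {μ : Measure G}

omit [ChartedSpace H G] in
lemma hasCompactSupport_leftAverage [IsTopologicalGroup G] [T2Space G] {f u : G → ℂ}
    (hf : HasCompactSupport f)
    (hu : HasCompactSupport u) : HasCompactSupport (leftAverage μ f u) := by
  refine HasCompactSupport.intro (hf.inv.mul hu) fun g hg ↦ ?_
  refine integral_eq_zero_of_ae (.of_forall fun y ↦ ?_)
  by_contra h
  obtain ⟨h1, h2⟩ := ne_zero_and_ne_zero_of_mul h
  refine hg ⟨y⁻¹, Set.inv_mem_inv.2 (subset_tsupport f h1), y * g, subset_tsupport u h2, ?_⟩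
  simp

omit [ChartedSpace H G] in
lemma integrable_mul_comp_mul_right [IsTopologicalGroup G] [T2Space G] [BorelSpace G] {f u : G → ℂ}
    (hf : LocallyIntegrable f μ) (hu : Continuous u)
    (hu' : HasCompactSupport u) (g : G) : Integrable (fun y ↦ f y * u (y * g)) μ :=
  hf.integrable_smul_right_of_hasCompactSupport (g := fun y ↦ u (y * g)) (by fun_prop)
    (hu'.comp_homeomorph (Homeomorph.mulRight g))

variable [LieGroup I ∞ G] [BorelSpace G]
variable [FiniteDimensional ℝ E] [I.Boundaryless] [T2Space G] [SecondCountableTopology G]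

lemma contMDiff_leftAverage {f u : G → ℂ} (hf : LocallyIntegrable f μ)
    (hu : ContMDiff I 𝓘(ℝ, ℂ) ∞ u) (hu' : HasCompactSupport u) :
    ContMDiff I 𝓘(ℝ, ℂ) ∞ (leftAverage μ f u) := by
  have := topologicalGroup_of_lieGroup I ∞ (G := G)
  have : LocallyCompactSpace G := Manifold.locallyCompact_of_finiteDimensional I
  refine contMDiff_integral_mul (K := fun g y ↦ u (y * g)) hf
    (hu.comp (contMDiff_snd.mul contMDiff_fst)) fun g₀ ↦ ?_
  obtain ⟨N, hN, hgN⟩ := exists_compact_mem_nhds g₀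
  refine ⟨tsupport u * N⁻¹, hu'.mul hN.inv, ?_⟩
  filter_upwards [hgN] with g hg y hy
  by_contra h
  exact hy ⟨y * g, subset_tsupport u h, g⁻¹, Set.inv_mem_inv.2 hg, by simp⟩

/-- Left-invariant derivatives commute with left translations, hence with averages of these. -/
lemma leftInvDeriv_leftAverage (v : GroupLieAlgebra I G) {f u : G → ℂ} (hf : LocallyIntegrable f μ)
    (hu : ContMDiff I 𝓘(ℝ, ℂ) ∞ u) (hu' : HasCompactSupport u) :
    leftInvDeriv v (leftAverage μ f u) = leftAverage μ f (leftInvDeriv v u) := by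
  have := topologicalGroup_of_lieGroup I ∞ (G := G)
  have : LocallyCompactSpace G := Manifold.locallyCompact_of_finiteDimensional I
  have : CompleteSpace E := FiniteDimensional.complete ℝ E
  funext g
  obtain ⟨ε, hε, γ, hγ0, hγc, hγ⟩ := exists_curve_hasDerivAt v
  have h0 : (0 : ℝ) ∈ Set.Icc (-ε) ε := ⟨by linarith, hε.le⟩
  have h1 := hγ _ (contMDiff_leftAverage hf hu hu') g 0 h0
  have hXu := contMDiff_leftInvDeriv v hu
  obtain ⟨C, hC⟩ := hXu.continuous.bounded_above_of_compact_support
    (hasCompactSupport_leftInvDeriv v hu')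
  have hmeas (w : G → ℂ) (hw : Continuous w) (z : G) :
      AEStronglyMeasurable (fun y ↦ f y * w (y * z)) μ :=
    hf.aestronglyMeasurable_smul (φ := fun y ↦ w (y * z)) (by fun_prop)
  have hint : Integrable (fun y ↦ f y * u (y * g)) μ :=
    integrable_mul_comp_mul_right hf hu.continuous hu' g
  -- For `t` near `0` the functions `y ↦ u (y g γ(t))` are supported in a common compact set.
  let D : Set G := tsupport u * ((fun t ↦ g * γ t) '' Set.Icc (-ε) ε)⁻¹
  have hD : IsCompact D := hu'.mul
    (isCompact_Icc.image_of_continuousOn (continuousOn_const.mul hγc)).inv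
  have hfD : Integrable (D.indicator f) μ :=
    (integrable_indicator_iff hD.measurableSet).2 (hf.integrableOn_isCompact hD)
  have h2 := (hasDerivAt_integral_of_dominated_loc_of_deriv_le (μ := μ) (𝕜 := ℝ) (x₀ := 0)
    (s := Set.Icc (-ε) ε) (F := fun t y ↦ f y * u (y * (g * γ t)))
    (F' := fun t y ↦ f y * leftInvDeriv v u (y * (g * γ t)))
    (bound := fun y ↦ ‖D.indicator f y‖ * C)
    (Icc_mem_nhds (by linarith) hε) (.of_forall fun t ↦ hmeas u hu.continuous _)
    (by simpa [hγ0] using hint)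
    (hmeas _ hXu.continuous _) (.of_forall fun y t ht ↦ ?_) (hfD.norm.mul_const C)
    (.of_forall fun y t ht ↦ ?_)).2
  · have h3 := h1.unique h2
    simpa [hγ0, leftAverage] using h3
  · refine norm_smul_le_of_norm_le_indicator (f := f) ?_
    by_cases hy : y ∈ D
    · simpa [hy] using hC _
    · have : y * (g * γ t) ∉ tsupport u := fun h ↦ hy
        ⟨_, h, (g * γ t)⁻¹, Set.inv_mem_inv.2 ⟨t, ht, rfl⟩, mul_inv_cancel_right _ _⟩
      simp [hy, leftInvDeriv_eq_zero_of_notMem_tsupport v this]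
  · simpa only [mul_assoc] using (hγ u hu (y * g) t ht).const_mul (f y)

variable [IsFiniteMeasureOnCompacts μ] [μ.IsMulRightInvariant]

/-- With the constant weight `1`, right invariance makes the average of the left translates of `u`
constant, so its derivative vanishes. -/
lemma integral_leftInvDeriv_eq_zero (v : GroupLieAlgebra I G) {u : G → ℂ}
    (hu : ContMDiff I 𝓘(ℝ, ℂ) ∞ u) (hu' : HasCompactSupport u) :
    ∫ g, leftInvDeriv v u g ∂μ = 0 := by
  have := topologicalGroup_of_lieGroup I ∞ (G := G)
  have : LocallyCompactSpace G := Manifold.locallyCompact_of_finiteDimensional I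
  have h1 : leftAverage μ (fun _ ↦ 1) u = fun _ ↦ ∫ y, u y ∂μ := by
    funext g
    simp [leftAverage, integral_mul_right_eq_self]
  have h2 := congrFun (leftInvDeriv_leftAverage v
    (locallyIntegrable_const (μ := μ) (1 : ℂ)) hu hu') 1
  rw [h1, leftInvDeriv_const] at h2
  simpa [leftAverage] using h2.symm

/-- Integration by parts along a left-invariant vector field. -/
lemma integral_leftInvDeriv_mul (v : GroupLieAlgebra I G) {u w : G → ℂ}
    (hu : ContMDiff I 𝓘(ℝ, ℂ) ∞ u) (hu' : HasCompactSupport u) (hw : ContMDiff I 𝓘(ℝ, ℂ) ∞ w) :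
    ∫ g, leftInvDeriv v u g * w g ∂μ = - ∫ g, u g * leftInvDeriv v w g ∂μ := by
  have h := integral_leftInvDeriv_eq_zero (μ := μ) v (u := fun g ↦ u g * w g)
    (contMDiff_mul_complex hu hw) hu'.mul_right
  simp only [leftInvDeriv_mul v hu hw] at h
  rw [integral_add] at h
  · linear_combination h
  · exact ((contMDiff_leftInvDeriv v hu).continuous.mul hw.continuous).integrable_of_hasCompactSupport
      (hasCompactSupport_leftInvDeriv v hu').mul_right
  · exact (hu.continuous.mul (contMDiff_leftInvDeriv v hw).continuous).integrable_of_hasCompactSupport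
      hu'.mul_right

lemma integral_sumOfSquares_mul {k : ℕ} (X : Fin k → GroupLieAlgebra I G) {u w : G → ℂ}
    (hu : ContMDiff I 𝓘(ℝ, ℂ) ∞ u) (hu' : HasCompactSupport u) (hw : ContMDiff I 𝓘(ℝ, ℂ) ∞ w) :
    ∫ g, sumOfSquares X u g * w g ∂μ =
      - ∑ j, ∫ g, leftInvDeriv (X j) u g * leftInvDeriv (X j) w g ∂μ := by
  simp only [sumOfSquares, Finset.sum_mul]
  rw [integral_finsetSum, ← Finset.sum_neg_distrib]
  · exact Finset.sum_congr rfl fun j _ ↦ integral_leftInvDeriv_mul _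
      (contMDiff_leftInvDeriv _ hu) (hasCompactSupport_leftInvDeriv _ hu') hw
  · intro j _
    exact ((contMDiff_leftInvDeriv _ (contMDiff_leftInvDeriv _ hu)).continuous.mul
      hw.continuous).integrable_of_hasCompactSupport
      (hasCompactSupport_leftInvDeriv _ (hasCompactSupport_leftInvDeriv _ hu')).mul_right

omit [IsFiniteMeasureOnCompacts μ] [μ.IsMulRightInvariant] in
lemma sumOfSquares_leftAverage {k : ℕ} (X : Fin k → GroupLieAlgebra I G) {f u : G → ℂ}
    (hf : LocallyIntegrable f μ) (hu : ContMDiff I 𝓘(ℝ, ℂ) ∞ u) (hu' : HasCompactSupport u) :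
    sumOfSquares X (leftAverage μ f u) = leftAverage μ f (sumOfSquares X u) := by
  funext g
  simp only [sumOfSquares, leftInvDeriv_leftAverage _ hf hu hu', leftInvDeriv_leftAverage _ hf
    (contMDiff_leftInvDeriv _ hu) (hasCompactSupport_leftInvDeriv _ hu'), leftAverage,
    Finset.mul_sum]
  rw [integral_finsetSum]
  have := topologicalGroup_of_lieGroup I ∞ (G := G)
  exact fun j _ ↦ integrable_mul_comp_mul_right hf
    (contMDiff_leftInvDeriv _ (contMDiff_leftInvDeriv _ hu)).continuous
    (hasCompactSupport_leftInvDeriv _ (hasCompactSupport_leftInvDeriv _ hu')) g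

end LeftAverage

/-! ### Mollification by left translations -/

section Mollification

open scoped Pointwise ENNReal

variable {G : Type*} [Group G] [MeasurableSpace G]

/-- The mollification `g ↦ ∫ f(h) φ(h g⁻¹) dμ(h)` of `f` by `φ`. For a right-invariant measure it is
the average of the left translates `g ↦ f(h g)` with weight `φ`. -/
def mollify (μ : Measure G) (f φ : G → ℂ) (g : G) : ℂ := ∫ h, f h * φ (h * g⁻¹) ∂μ

variable [TopologicalSpace G] [BorelSpace G] [T2Space G] [SecondCountableTopology G]
  {μ : Measure G} [IsFiniteMeasureOnCompacts μ] [μ.IsMulRightInvariant]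

section TopologicalGroup

variable [IsTopologicalGroup G] [LocallyCompactSpace G]

/-- Left translation by `h` multiplies a right Haar measure by a constant (the inverse measure is a
left Haar measure, which is unique up to scaling), and this constant is bounded for `h` in a compact
set. -/
lemma exists_map_mul_left_le [μ.IsOpenPosMeasure] {S : Set G} (hS : IsCompact S) :
    ∃ C : ℝ≥0∞, C ≠ ⊤ ∧ ∀ h ∈ S, μ.map (h * ·) ≤ C • μ := by
  obtain ⟨A, hA, hA1⟩ := exists_compact_mem_nhds (1 : G)
  have hA0 : μ A ≠ 0 := (Measure.measure_pos_of_mem_nhds μ hA1).ne'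
  have hfin : μ (S⁻¹ * A) ≠ ⊤ := (hS.inv.mul hA).measure_lt_top.ne
  refine ⟨μ (S⁻¹ * A) / μ A, ENNReal.div_ne_top hfin hA0, fun h hh ↦ ?_⟩
  have : IsFiniteMeasureOnCompacts μ.inv := inferInstance
  have : μ.inv.IsHaarMeasure := {}
  have : IsFiniteMeasureOnCompacts (μ.inv.map (· * h⁻¹)) :=
    Measure.IsFiniteMeasureOnCompacts.map _ (Homeomorph.mulRight h⁻¹)
  have hc := Measure.isMulLeftInvariant_eq_smul (μ.inv.map (· * h⁻¹)) μ.inv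
  set c := Measure.haarScalarFactor (μ.inv.map (· * h⁻¹)) μ.inv
  have hc' : μ.map (h * ·) = c • μ := by
    have := congrArg (Measure.map Inv.inv) hc
    rw [Measure.map_smul, Measure.inv, Measure.map_map (measurable_mul_const _) measurable_inv,
      Measure.map_map measurable_inv ((measurable_mul_const _).comp measurable_inv),
      Measure.map_map measurable_inv measurable_inv] at this
    simpa [Function.comp_def] using this
  have hcle : (c : ℝ≥0∞) ≤ μ (S⁻¹ * A) / μ A := by
    rw [ENNReal.le_div_iff_mul_le (.inl hA0) (.inl hA.measure_lt_top.ne)]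
    calc c * μ A = μ.map (h * ·) A := by rw [hc']; rfl
      _ = μ ((h * ·) ⁻¹' A) := Measure.map_apply (measurable_const_mul h) hA.measurableSet
      _ ≤ _ := measure_mono fun a ha ↦ Set.mem_mul.2 ⟨h⁻¹, Set.inv_mem_inv.2 hh, h * a, ha, by simp⟩
  rw [hc']
  refine fun s ↦ ?_
  change (c : ℝ≥0∞) * μ s ≤ _ * μ s
  gcongr

omit [IsFiniteMeasureOnCompacts μ] [T2Space G] [SecondCountableTopology G]
  [LocallyCompactSpace G] in
lemma mollify_eq_integral_mul_right (f φ : G → ℂ) (g : G) :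
    mollify μ f φ g = ∫ h, f (h * g) * φ h ∂μ := by
  rw [mollify, ← integral_mul_right_eq_self _ g]
  simp

lemma lintegral_enorm_mollify_sq_lt_top [μ.IsOpenPosMeasure] {f φ : G → ℂ}
    (hfm : StronglyMeasurable f) (hf : MemLp f 2 μ) (hφ : Continuous φ) (hφ' : HasCompactSupport φ) :
    ∫⁻ g, ‖mollify μ f φ g‖ₑ ^ 2 ∂μ < ⊤ := by
  have hfm' : Measurable fun p : G × G ↦ ‖f (p.2 * p.1)‖ₑ :=
    (hfm.measurable.comp (measurable_snd.mul measurable_fst)).enorm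
  have hφm : Measurable fun h ↦ ‖φ h‖ₑ := hφ.measurable.enorm
  -- The Cauchy-Schwarz inequality for the finite measure with density `‖φ‖`.
  let ν : Measure G := μ.withDensity fun h ↦ ‖φ h‖ₑ
  have hν : ν Set.univ < ⊤ := by
    rw [withDensity_apply _ .univ, Measure.restrict_univ]
    exact (hφ.integrable_of_hasCompactSupport hφ').2
  have hpt (g : G) : ‖mollify μ f φ g‖ₑ ^ 2 ≤ ν Set.univ * ∫⁻ h, ‖φ h‖ₑ * ‖f (h * g)‖ₑ ^ 2 ∂μ := by
    have hm : Measurable fun h ↦ ‖f (h * g)‖ₑ := hfm'.comp (measurable_prodMk_left (x := g))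
    have h1 : ‖mollify μ f φ g‖ₑ ≤ ∫⁻ h, ‖f (h * g)‖ₑ ∂ν := by
      rw [mollify_eq_integral_mul_right, lintegral_withDensity_eq_lintegral_mul _ hφm hm]
      refine (enorm_integral_le_lintegral_enorm _).trans_eq (lintegral_congr fun h ↦ ?_)
      simp [mul_comm]
    have h2 := ENNReal.lintegral_mul_le_Lp_mul_Lq ν Real.HolderConjugate.two_two
      hm.aemeasurable (aemeasurable_const (b := (1 : ℝ≥0∞)))
    have h3 : ∫⁻ h, ‖f (h * g)‖ₑ ^ (2 : ℝ) ∂ν = ∫⁻ h, ‖φ h‖ₑ * ‖f (h * g)‖ₑ ^ 2 ∂μ := by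
      rw [lintegral_withDensity_eq_lintegral_mul _ hφm (hm.pow_const _)]
      simp
    simp only [Pi.mul_apply, mul_one, ENNReal.one_rpow, lintegral_const, one_mul, h3] at h2
    calc ‖mollify μ f φ g‖ₑ ^ 2 ≤ ((∫⁻ h, ‖φ h‖ₑ * ‖f (h * g)‖ₑ ^ 2 ∂μ) ^ (1 / 2 : ℝ) *
          ν Set.univ ^ (1 / 2 : ℝ)) ^ 2 := by
          gcongr
          exact h1.trans h2
      _ = _ := by
        rw [mul_pow, ← ENNReal.rpow_natCast, ← ENNReal.rpow_natCast, ← ENNReal.rpow_mul,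
          ← ENNReal.rpow_mul]
        norm_num [mul_comm]
  obtain ⟨C, hC, hCS⟩ := exists_map_mul_left_le (μ := μ) hφ'.isCompact
  have hf2 : ∫⁻ g, ‖f g‖ₑ ^ 2 ∂μ < ⊤ := by
    have := (eLpNorm_lt_top_iff_lintegral_rpow_enorm_lt_top two_ne_zero ENNReal.ofNat_ne_top).1 hf.2
    simpa using this
  have hin (h : G) : ‖φ h‖ₑ * ∫⁻ g, ‖f (h * g)‖ₑ ^ 2 ∂μ ≤ ‖φ h‖ₑ * (C * ∫⁻ g, ‖f g‖ₑ ^ 2 ∂μ) := by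
    by_cases hh : h ∈ tsupport φ
    · gcongr
      calc ∫⁻ g, ‖f (h * g)‖ₑ ^ 2 ∂μ = ∫⁻ g, ‖f g‖ₑ ^ 2 ∂(μ.map (h * ·)) :=
            (lintegral_map (hfm.measurable.enorm.pow_const _) (measurable_const_mul h)).symm
        _ ≤ ∫⁻ g, ‖f g‖ₑ ^ 2 ∂(C • μ) := lintegral_mono' (hCS h hh) le_rfl
        _ = _ := lintegral_smul_measure _ _
    · simp [image_eq_zero_of_notMem_tsupport hh]
  calc ∫⁻ g, ‖mollify μ f φ g‖ₑ ^ 2 ∂μ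
      ≤ ∫⁻ g, ν Set.univ * ∫⁻ h, ‖φ h‖ₑ * ‖f (h * g)‖ₑ ^ 2 ∂μ ∂μ := lintegral_mono hpt
    _ = ν Set.univ * ∫⁻ h, ∫⁻ g, ‖φ h‖ₑ * ‖f (h * g)‖ₑ ^ 2 ∂μ ∂μ := by
        rw [lintegral_const_mul' _ _ hν.ne, lintegral_lintegral_swap]
        exact ((hφm.comp measurable_snd).mul (hfm'.pow_const 2)).aemeasurable
    _ ≤ ν Set.univ * ∫⁻ h, ‖φ h‖ₑ * (C * ∫⁻ g, ‖f g‖ₑ ^ 2 ∂μ) ∂μ := by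
        gcongr with h
        rw [lintegral_const_mul' _ _ enorm_ne_top]
        exact hin h
    _ < ⊤ := by
        rw [lintegral_mul_const _ hφm]
        exact ENNReal.mul_lt_top hν (ENNReal.mul_lt_top
          (hφ.integrable_of_hasCompactSupport hφ').2 (ENNReal.mul_lt_top hC.lt_top hf2))

/-- The transpose of mollification by `φ` is averaging with the weight `y ↦ φ y⁻¹`. -/
lemma integral_mollify_mul {f φ v : G → ℂ} (hfm : StronglyMeasurable f)
    (hf : LocallyIntegrable f μ) (hφ : Continuous φ) (hφ' : HasCompactSupport φ)
    (hv : Continuous v) (hv' : HasCompactSupport v) :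
    ∫ g, mollify μ f φ g * v g ∂μ = ∫ h, f h * leftAverage μ (fun y ↦ φ y⁻¹) v h ∂μ := by
  obtain ⟨C, hC⟩ := hφ.bounded_above_of_compact_support hφ'
  let D : Set G := tsupport φ * tsupport v
  have hD : IsCompact D := hφ'.isCompact.mul hv'.isCompact
  have hfD : Integrable (D.indicator f) μ :=
    (integrable_indicator_iff hD.measurableSet).2 (hf.integrableOn_isCompact hD)
  have hint : Integrable (Function.uncurry fun g h ↦ f h * φ (h * g⁻¹) * v g) (μ.prod μ) := by
    refine (((hv.integrable_of_hasCompactSupport hv').mul_prod hfD).norm.mul_const C).mono'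
      ?_ (.of_forall fun ⟨g, h⟩ ↦ ?_)
    · exact (((hfm.comp_measurable measurable_snd).mul (by fun_prop :
        Continuous fun p : G × G ↦ φ (p.2 * p.1⁻¹)).stronglyMeasurable).mul
        (by fun_prop : Continuous fun p : G × G ↦ v p.1).stronglyMeasurable).aestronglyMeasurable
    · simp only [Function.uncurry_apply_pair, norm_mul]
      by_cases hg : g ∈ tsupport v
      · by_cases hh : h * g⁻¹ ∈ tsupport φ
        · have : h ∈ D := ⟨h * g⁻¹, hh, g, hg, by simp⟩
          simp only [this, Set.indicator_of_mem]
          nlinarith [mul_le_mul_of_nonneg_left (hC (h * g⁻¹))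
            (mul_nonneg (norm_nonneg (v g)) (norm_nonneg (f h)))]
        · rw [image_eq_zero_of_notMem_tsupport hh]
          have := (norm_nonneg (φ 1)).trans (hC 1)
          simp only [norm_zero, mul_zero, zero_mul]
          positivity
      · simp [image_eq_zero_of_notMem_tsupport hg]
  calc ∫ g, mollify μ f φ g * v g ∂μ = ∫ g, ∫ h, f h * φ (h * g⁻¹) * v g ∂μ ∂μ := by
        simp only [mollify, integral_mul_const]
    _ = ∫ h, ∫ g, f h * φ (h * g⁻¹) * v g ∂μ ∂μ := integral_integral_swap hint
    _ = _ := by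
        refine integral_congr_ae (.of_forall fun h ↦ ?_)
        simp only [leftAverage, mul_assoc, integral_const_mul]
        congr 1
        rw [← integral_mul_right_eq_self _ h]
        simp

end TopologicalGroup

variable {E : Type*} [NormedAddCommGroup E] [NormedSpace ℝ E] [FiniteDimensional ℝ E]
  {H : Type*} [TopologicalSpace H] {I : ModelWithCorners ℝ E H} [I.Boundaryless]
  [ChartedSpace H G] [LieGroup I ∞ G]

omit [IsFiniteMeasureOnCompacts μ] [μ.IsMulRightInvariant] in
lemma contMDiff_mollify {f φ : G → ℂ} (hf : LocallyIntegrable f μ)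
    (hφ : ContMDiff I 𝓘(ℝ, ℂ) ∞ φ) (hφ' : HasCompactSupport φ) :
    ContMDiff I 𝓘(ℝ, ℂ) ∞ (mollify μ f φ) := by
  have := topologicalGroup_of_lieGroup I ∞ (G := G)
  have : LocallyCompactSpace G := Manifold.locallyCompact_of_finiteDimensional I
  refine contMDiff_integral_mul (K := fun g y ↦ φ (y * g⁻¹)) hf
    (hφ.comp (contMDiff_snd.mul contMDiff_fst.inv)) fun g₀ ↦ ?_
  obtain ⟨N, hN, hgN⟩ := exists_compact_mem_nhds g₀
  refine ⟨tsupport φ * N, hφ'.isCompact.mul hN, ?_⟩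
  filter_upwards [hgN] with g hg y hy
  by_contra h
  exact hy ⟨y * g⁻¹, subset_tsupport φ h, g, hg, by simp⟩

end Mollification

/-! ### Cutoff functions and the energy estimate -/

section Uniqueness

open Filter Topology

variable {E : Type*} [NormedAddCommGroup E] [NormedSpace ℝ E] [FiniteDimensional ℝ E]
  {H : Type*} [TopologicalSpace H] {I : ModelWithCorners ℝ E H} [I.Boundaryless]
  {G : Type*} [TopologicalSpace G] [T2Space G] [SecondCountableTopology G]
  [ChartedSpace H G] [Group G] [LieGroup I ∞ G] [MeasurableSpace G] [BorelSpace G]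
  {μ : Measure G} [IsFiniteMeasureOnCompacts μ] [μ.IsMulRightInvariant]

/-- The left-hand side plus `‖a * b + c * w‖ ^ 2` equals the right-hand side. -/
lemma re_cutoff_mul_ge {a c w b : ℂ} (ha : star a = a) (hc : star c = c) :
    -(‖c‖ ^ 2 * ‖w‖ ^ 2) ≤ ((c * (a * star w) + a * (c * star w + a * star b)) * b).re := by
  have ha' : a.im = 0 := Complex.conj_eq_iff_im.1 ha
  have hc' : c.im = 0 := Complex.conj_eq_iff_im.1 hc
  simp only [Complex.sq_norm, Complex.normSq_apply, Complex.mul_re, Complex.mul_im, Complex.add_re,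
    Complex.add_im, Complex.star_def, Complex.conj_re, Complex.conj_im, ha', hc']
  nlinarith [sq_nonneg (a.re * b.re + c.re * w.re), sq_nonneg (a.re * b.im + c.re * w.im)]

/-- The energy estimate: it bounds a weak solution of `w - L w = 0` on a cutoff region by its size
where the cutoff function varies. It comes from testing the equation with `χ ^ 2 * conj w`. -/
lemma integral_cutoff_sq_le {k : ℕ} (X : Fin k → GroupLieAlgebra I G) {w χ : G → ℂ}
    (hw : ContMDiff I 𝓘(ℝ, ℂ) ∞ w)
    (hwL : ∀ u : G → ℂ, ContMDiff I 𝓘(ℝ, ℂ) ∞ u → HasCompactSupport u →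
      ∫ g, w g * (u g - sumOfSquares X u g) ∂μ = 0)
    (hχ : ContMDiff I 𝓘(ℝ, ℂ) ∞ χ) (hχ' : HasCompactSupport χ) (hχr : ∀ g, star (χ g) = χ g) :
    ∫ g, ‖χ g‖ ^ 2 * ‖w g‖ ^ 2 ∂μ ≤
      ∑ j, ∫ g, ‖leftInvDeriv (X j) χ g‖ ^ 2 * ‖w g‖ ^ 2 ∂μ := by
  have hwc : ContMDiff I 𝓘(ℝ, ℂ) ∞ (fun g ↦ star (w g)) :=
    (Complex.conjCLE.contDiff (n := ∞)).comp_contMDiff hw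
  have hχw := contMDiff_mul_complex hχ hwc
  let u : G → ℂ := fun g ↦ χ g * (χ g * star (w g))
  have hu : ContMDiff I 𝓘(ℝ, ℂ) ∞ u := contMDiff_mul_complex hχ hχw
  have hu' : HasCompactSupport u := hχ'.mul_right
  have hXχr (j) (g) : star (leftInvDeriv (X j) χ g) = leftInvDeriv (X j) χ g := by
    rw [← leftInvDeriv_conj _ hχ]; simp only [hχr]
  have hXu (j) (g) : leftInvDeriv (X j) u g = leftInvDeriv (X j) χ g * (χ g * star (w g)) +
      χ g * (leftInvDeriv (X j) χ g * star (w g) + χ g * star (leftInvDeriv (X j) w g)) := by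
    rw [leftInvDeriv_mul _ hχ hχw, leftInvDeriv_mul _ hχ hwc, leftInvDeriv_conj _ hw]
  have hLu : HasCompactSupport (sumOfSquares X u) := (sumOfSquaresTest X ⟨u, hu, hu'⟩).2.2
  have hLuc : Continuous (sumOfSquares X u) := (sumOfSquaresTest X ⟨u, hu, hu'⟩).2.1.continuous
  have h1 : ∫ g, u g * w g ∂μ =
      -∑ j, ∫ g, leftInvDeriv (X j) u g * leftInvDeriv (X j) w g ∂μ := by
    rw [← integral_sumOfSquares_mul X hu hu' hw, ← sub_eq_zero, ← integral_sub, ← hwL u hu hu']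
    · congr 1 with g; ring
    · exact (hu.continuous.mul hw.continuous).integrable_of_hasCompactSupport hu'.mul_right
    · exact (hLuc.mul hw.continuous).integrable_of_hasCompactSupport hLu.mul_right
  have h2 : ∫ g, ‖χ g‖ ^ 2 * ‖w g‖ ^ 2 ∂μ = (∫ g, u g * w g ∂μ).re := by
    rw [← Complex.ofReal_re (∫ g, ‖χ g‖ ^ 2 * ‖w g‖ ^ 2 ∂μ), ← integral_complex_ofReal]
    congr 2 with g
    have e1 : ((‖χ g‖ ^ 2 : ℝ) : ℂ) = χ g * χ g := by
      nth_rw 2 [← hχr]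
      simp [Complex.conj_mul']
    have e2 : ((‖w g‖ ^ 2 : ℝ) : ℂ) = star (w g) * w g := by
      simp [Complex.conj_mul']
    rw [Complex.ofReal_mul, e1, e2]
    ring
  rw [h2, h1, Complex.neg_re, Complex.re_sum, ← Finset.sum_neg_distrib]
  refine Finset.sum_le_sum fun j _ ↦ ?_
  have hint : Integrable (fun g ↦ leftInvDeriv (X j) u g * leftInvDeriv (X j) w g) μ :=
    ((contMDiff_leftInvDeriv _ hu).continuous.mul
      (contMDiff_leftInvDeriv _ hw).continuous).integrable_of_hasCompactSupport
      (hasCompactSupport_leftInvDeriv _ hu').mul_right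
  have e := integral_re hint
  simp only [RCLike.re_eq_complex_re] at e
  rw [← e, ← integral_neg]
  refine integral_mono hint.re.neg ?_ fun g ↦ ?_
  · refine Continuous.integrable_of_hasCompactSupport ?_ ?_
    · exact ((contMDiff_leftInvDeriv _ hχ).continuous.norm.pow 2).mul (hw.continuous.norm.pow 2)
    · refine HasCompactSupport.mul_right (f := fun g ↦ ‖leftInvDeriv (X j) χ g‖ ^ 2) ?_
      exact (hasCompactSupport_leftInvDeriv (X j) hχ').comp_left (g := fun z : ℂ ↦ ‖z‖ ^ 2) (by simp)
  · have := re_cutoff_mul_ge (w := w g) (b := leftInvDeriv (X j) w g) (hχr g) (hXχr j g)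
    rw [← hXu] at this
    simpa using neg_le_neg this

omit [μ.IsMulRightInvariant] in
lemma exists_integral_eq_one (I : ModelWithCorners ℝ E H) [I.Boundaryless] [LieGroup I ∞ G]
    [μ.IsOpenPosMeasure] :
    ∃ ψ : G → ℂ, ContMDiff I 𝓘(ℝ, ℂ) ∞ ψ ∧ HasCompactSupport ψ ∧ (∀ g, star (ψ g) = ψ g) ∧
      ∫ g, ψ g ∂μ = 1 := by
  have : LocallyCompactSpace G := Manifold.locallyCompact_of_finiteDimensional I
  have : IsManifold I ∞ G := inferInstance
  obtain ⟨ψ, hψ, hψ', hne⟩ : ∃ ψ : G → ℝ, ContMDiff I 𝓘(ℝ, ℝ) ∞ ψ ∧ HasCompactSupport ψ ∧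
      ∫ g, ψ g ∂μ ≠ 0 := by
    by_contra! hcon
    have h := ae_eq_zero_of_integral_contMDiff_smul_eq_zero (μ := μ) I
      (locallyIntegrable_const (1 : ℝ)) (by simpa using hcon)
    have h2 : μ Set.univ = 0 := by simpa [ae_iff] using h
    exact isOpen_univ.measure_ne_zero μ Set.univ_nonempty h2
  refine ⟨fun g ↦ ((∫ x, ψ x ∂μ)⁻¹ * ψ g : ℝ), ?_, ?_, fun g ↦ Complex.conj_ofReal _, ?_⟩
  · exact (show ContDiff ℝ ∞ (fun t : ℝ ↦ (((∫ x, ψ x ∂μ)⁻¹ * t : ℝ) : ℂ)) from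
      Complex.ofRealCLM.contDiff.comp (contDiff_const.mul contDiff_id)).comp_contMDiff hψ
  · exact hψ'.comp_left (g := fun t : ℝ ↦ (((∫ x, ψ x ∂μ)⁻¹ * t : ℝ) : ℂ)) (by simp)
  · rw [integral_complex_ofReal, integral_const_mul, inv_mul_cancel₀ hne, Complex.ofReal_one]

lemma exists_cutoff (I : ModelWithCorners ℝ E H) [I.Boundaryless] [LieGroup I ∞ G]
    [μ.IsOpenPosMeasure] :
    ∃ χ : ℕ → G → ℂ, (∀ n, ContMDiff I 𝓘(ℝ, ℂ) ∞ (χ n)) ∧ (∀ n, HasCompactSupport (χ n)) ∧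
      (∀ n g, star (χ n g) = χ n g) ∧ (∃ C, ∀ n g, ‖χ n g‖ ≤ C) ∧
      (∀ g, Tendsto (fun n ↦ χ n g) atTop (𝓝 1)) ∧
      ∀ v : GroupLieAlgebra I G, (∃ C, ∀ n g, ‖leftInvDeriv v (χ n) g‖ ≤ C) ∧
        ∀ g, Tendsto (fun n ↦ leftInvDeriv v (χ n) g) atTop (𝓝 0) := by
  have := topologicalGroup_of_lieGroup I ∞ (G := G)
  have : LocallyCompactSpace G := Manifold.locallyCompact_of_finiteDimensional I
  obtain ⟨ψ, hψ, hψ', hψr, hψ1⟩ := exists_integral_eq_one (μ := μ) I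
  let f : ℕ → G → ℂ := fun n ↦ (compactCovering G n).indicator fun _ ↦ 1
  have hK (n) : IsCompact (compactCovering G n) := isCompact_compactCovering G n
  have hf1 (n g) : ‖f n g‖ ≤ 1 := (norm_indicator_le_norm_self _ g).trans (by simp)
  have hf (n) : LocallyIntegrable (f n) μ :=
    ((integrable_indicator_iff (hK n).measurableSet).2
      (integrableOn_const (hK n).measure_lt_top.ne)).locallyIntegrable
  have hf' (n) : HasCompactSupport (f n) :=
    HasCompactSupport.intro (hK n) fun x hx ↦ Set.indicator_of_notMem hx _
  have hfr (n g) : star (f n g) = f n g := by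
    by_cases h : g ∈ compactCovering G n <;> simp [f, h]
  have hlim (g) : Tendsto (fun n ↦ f n g) atTop (𝓝 1) := by
    obtain ⟨N, hN⟩ := exists_mem_compactCovering g
    refine tendsto_const_nhds.congr' ?_
    filter_upwards [eventually_ge_atTop N] with n hn
    simp [f, compactCovering_subset G hn hN]
  -- Averaging against the indicators of an exhaustion is bounded, and tends to the total integral.
  have hbound (u : G → ℂ) (hu : Continuous u) (hu' : HasCompactSupport u) :
      (∃ C, ∀ n g, ‖leftAverage μ (f n) u g‖ ≤ C) ∧
        ∀ g, Tendsto (fun n ↦ leftAverage μ (f n) u g) atTop (𝓝 (∫ x, u x ∂μ)) := by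
    have hui : Integrable u μ := hu.integrable_of_hasCompactSupport hu'
    have hle (n g y) : ‖f n y * u (y * g)‖ ≤ ‖u (y * g)‖ := by
      rw [norm_mul]
      exact mul_le_of_le_one_left (norm_nonneg _) (hf1 n y)
    refine ⟨⟨∫ x, ‖u x‖ ∂μ, fun n g ↦ ?_⟩, fun g ↦ ?_⟩
    · rw [← integral_mul_right_eq_self _ g]
      exact norm_integral_le_of_norm_le (hui.norm.comp_mul_right g) (.of_forall fun y ↦ hle n g y)
    · rw [← integral_mul_right_eq_self _ g]
      refine tendsto_integral_of_dominated_convergence (fun y ↦ ‖u (y * g)‖)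
        (fun n ↦ ((hf n).aestronglyMeasurable_smul (φ := fun y ↦ u (y * g)) (by fun_prop)))
        (hui.norm.comp_mul_right g) (fun n ↦ .of_forall fun y ↦ hle n g y)
        (.of_forall fun y ↦ ?_)
      simpa using (hlim y).mul_const (u (y * g))
  refine ⟨fun n ↦ leftAverage μ (f n) ψ, fun n ↦ contMDiff_leftAverage (hf n) hψ hψ',
    fun n ↦ hasCompactSupport_leftAverage (hf' n) hψ', fun n g ↦ ?_,
    (hbound ψ hψ.continuous hψ').1, ?_, fun v ↦ ?_⟩
  · simp only [leftAverage]
    rw [Complex.star_def, ← integral_conj]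
    congr 1 with y
    rw [map_mul]
    exact congrArg₂ _ (hfr n y) (hψr _)
  · simpa [hψ1] using (hbound ψ hψ.continuous hψ').2
  · have := hbound _ (contMDiff_leftInvDeriv v hψ).continuous (hasCompactSupport_leftInvDeriv v hψ')
    rw [integral_leftInvDeriv_eq_zero v hψ hψ'] at this
    simpa only [leftInvDeriv_leftAverage v (hf _) hψ hψ'] using this

/-- A smooth square-integrable weak solution of `w - L w = 0` vanishes. -/
theorem eq_zero_of_integral_mul_sub_sumOfSquares_eq_zero [μ.IsOpenPosMeasure] {k : ℕ}
    (X : Fin k → GroupLieAlgebra I G) {w : G → ℂ} (hw : ContMDiff I 𝓘(ℝ, ℂ) ∞ w)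
    (hw2 : Integrable (fun g ↦ ‖w g‖ ^ 2) μ)
    (hwL : ∀ u : G → ℂ, ContMDiff I 𝓘(ℝ, ℂ) ∞ u → HasCompactSupport u →
      ∫ g, w g * (u g - sumOfSquares X u g) ∂μ = 0) : w = 0 := by
  obtain ⟨χ, hχ, hχ', hχr, ⟨C, hC⟩, hχ1, hXχ⟩ := exists_cutoff (μ := μ) I
  have hlim (ξ : ℕ → G → ℂ) (hξ : ∀ n, Continuous (ξ n)) (C : ℝ) (hC : ∀ n g, ‖ξ n g‖ ≤ C) (c : ℂ)
      (hc : ∀ g, Tendsto (fun n ↦ ξ n g) atTop (𝓝 c)) :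
      Tendsto (fun n ↦ ∫ g, ‖ξ n g‖ ^ 2 * ‖w g‖ ^ 2 ∂μ) atTop
        (𝓝 (∫ g, ‖c‖ ^ 2 * ‖w g‖ ^ 2 ∂μ)) := by
    refine tendsto_integral_of_dominated_convergence (fun g ↦ C ^ 2 * ‖w g‖ ^ 2)
      (fun n ↦ (((hξ n).norm.pow 2).mul (hw.continuous.norm.pow 2)).aestronglyMeasurable)
      (hw2.const_mul _) (fun n ↦ .of_forall fun g ↦ ?_) (.of_forall fun g ↦ ?_)
    · rw [Real.norm_of_nonneg (by positivity)]
      gcongr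
      exact hC n g
    · exact (((hc g).norm).pow 2).mul_const _
  have h1 := hlim χ (fun n ↦ (hχ n).continuous) C hC 1 hχ1
  have h2 : Tendsto (fun n ↦ ∑ j, ∫ g, ‖leftInvDeriv (X j) (χ n) g‖ ^ 2 * ‖w g‖ ^ 2 ∂μ) atTop
      (𝓝 (∑ j : Fin k, ∫ g, ‖(0 : ℂ)‖ ^ 2 * ‖w g‖ ^ 2 ∂μ)) := by
    refine tendsto_finsetSum _ fun j _ ↦ ?_
    obtain ⟨⟨C', hC'⟩, h0⟩ := hXχ (X j)
    exact hlim _ (fun n ↦ (contMDiff_leftInvDeriv _ (hχ n)).continuous) C' hC' 0 h0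
  have h3 := le_of_tendsto_of_tendsto' h1 h2 fun n ↦
    integral_cutoff_sq_le X hw hwL (hχ n) (hχ' n) (hχr n)
  simp only [norm_one, norm_zero, one_pow, one_mul, ne_eq, OfNat.ofNat_ne_zero, not_false_eq_true,
    zero_pow, zero_mul, integral_zero, Finset.sum_const_zero] at h3
  have h4 : ∫ g, ‖w g‖ ^ 2 ∂μ = 0 := le_antisymm h3 (integral_nonneg fun g ↦ by positivity)
  rw [integral_eq_zero_iff_of_nonneg (fun g ↦ by positivity) hw2] at h4
  have h5 : w =ᵐ[μ] 0 := by
    filter_upwards [h4] with g hg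
    simpa using hg
  exact (hw.continuous.ae_eq_iff_eq μ continuous_zero).1 h5

end Uniqueness

/-! ### The sum of squares on square-integrable functions -/

section EssentialSelfAdjointnessOfSumOfSquares

open scoped InnerProductSpace

variable {E : Type*} [NormedAddCommGroup E] [NormedSpace ℝ E]
  {H : Type*} [TopologicalSpace H] {I : ModelWithCorners ℝ E H}
  {G : Type*} [TopologicalSpace G] [ChartedSpace H G] [Group G] [LieGroup I ∞ G]

omit [Group G] [LieGroup I ∞ G] in
lemma conj_mem_smoothCompactlySupported {u : G → ℂ} (hu : u ∈ smoothCompactlySupported I G) :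
    (fun g ↦ star (u g)) ∈ smoothCompactlySupported I G :=
  ⟨(Complex.conjCLE.contDiff (n := ∞)).comp_contMDiff hu.1,
    hu.2.comp_left (g := fun z : ℂ ↦ star z) (star_zero _)⟩

lemma sumOfSquares_conj {k : ℕ} (X : Fin k → GroupLieAlgebra I G) {u : G → ℂ}
    (hu : ContMDiff I 𝓘(ℝ, ℂ) ∞ u) (g : G) :
    sumOfSquares X (fun g ↦ star (u g)) g = star (sumOfSquares X u g) := by
  have h (v : GroupLieAlgebra I G) : leftInvDeriv v (fun g ↦ star (u g)) =
      fun g ↦ star (leftInvDeriv v u g) := funext fun g ↦ leftInvDeriv_conj v hu g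
  simp only [sumOfSquares, h, leftInvDeriv_conj _ (contMDiff_leftInvDeriv _ hu), star_sum]

lemma star_sumOfSquaresTest_apply {k : ℕ} (X : Fin k → GroupLieAlgebra I G)
    (u : smoothCompactlySupported I G) (g : G) :
    star ((sumOfSquaresTest X u : G → ℂ) g) = sumOfSquares X (fun g ↦ star ((u : G → ℂ) g)) g :=
  (sumOfSquares_conj X u.2.1 g).symm

variable [MeasurableSpace G] [BorelSpace G] {μ : Measure G} [IsFiniteMeasureOnCompacts μ]

omit [LieGroup I ∞ G] in
lemma inner_testToL2_right (y : Lp ℂ 2 μ) (u : smoothCompactlySupported I G) :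
    ⟪y, testToL2 I μ u⟫_ℂ = ∫ g, star (y g) * (u : G → ℂ) g ∂μ := by
  rw [L2.inner_def]
  refine integral_congr_ae ?_
  filter_upwards [(memLp_smoothCompactlySupported μ u).coeFn_toLp] with g hg
  have : (testToL2 I μ u : G → ℂ) g = (u : G → ℂ) g := hg
  rw [this, RCLike.inner_apply, mul_comm]
  rfl

omit [LieGroup I ∞ G] in
lemma inner_testToL2_testToL2 (u w : smoothCompactlySupported I G) :
    ⟪testToL2 I μ u, testToL2 I μ w⟫_ℂ = ∫ g, star ((u : G → ℂ) g) * (w : G → ℂ) g ∂μ := by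
  rw [inner_testToL2_right]
  refine integral_congr_ae ?_
  filter_upwards [(memLp_smoothCompactlySupported μ u).coeFn_toLp] with g hg
  have : (testToL2 I μ u : G → ℂ) g = (u : G → ℂ) g := hg
  rw [this]

lemma exists_sumOfSquaresL2_apply_eq [μ.IsOpenPosMeasure] {k : ℕ} (X : Fin k → GroupLieAlgebra I G)
    (x : (sumOfSquaresL2 X μ).domain) :
    ∃ u : smoothCompactlySupported I G, (x : Lp ℂ 2 μ) = testToL2 I μ u ∧
      sumOfSquaresL2 X μ x = testToL2 I μ (sumOfSquaresTest X u) := by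
  obtain ⟨x, u, rfl⟩ := x
  refine ⟨u, rfl, ?_⟩
  change testToL2 I μ (sumOfSquaresTest X _) = _
  congr 2
  exact (LinearEquiv.symm_apply_eq _).2 rfl

variable [FiniteDimensional ℝ E] [I.Boundaryless] [T2Space G] [SecondCountableTopology G]

omit [I.Boundaryless] [IsFiniteMeasureOnCompacts μ] in
lemma ae_eq_zero_of_integral_mul_test_eq_zero {f : G → ℂ} (hf : LocallyIntegrable f μ)
    (h : ∀ u ∈ smoothCompactlySupported I G, ∫ g, f g * u g ∂μ = 0) : f =ᵐ[μ] 0 := by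
  have : LocallyCompactSpace G := Manifold.locallyCompact_of_finiteDimensional I
  have : IsManifold I ∞ G := inferInstance
  refine ae_eq_zero_of_integral_contMDiff_smul_eq_zero I hf fun φ hφ hφ' ↦ ?_
  rw [← h (fun g ↦ (φ g : ℂ)) ⟨Complex.ofRealCLM.contDiff.comp_contMDiff hφ,
    hφ'.comp_left (g := fun t : ℝ ↦ (t : ℂ)) (by simp)⟩]
  congr 1 with g
  simp [mul_comm]

/-- A square-integrable weak solution of `f - L f = 0` vanishes: so do all its mollifications, whose
values at the identity are the integrals of `f` against test functions. -/
theorem ae_eq_zero_of_integral_mul_sub_sumOfSquares_eq_zero [μ.IsMulRightInvariant]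
    [μ.IsOpenPosMeasure] {k : ℕ} (X : Fin k → GroupLieAlgebra I G) {f : G → ℂ}
    (hfm : StronglyMeasurable f) (hf : MemLp f 2 μ)
    (hfL : ∀ u ∈ smoothCompactlySupported I G, ∫ g, f g * (u g - sumOfSquares X u g) ∂μ = 0) :
    f =ᵐ[μ] 0 := by
  have := topologicalGroup_of_lieGroup I ∞ (G := G)
  have : LocallyCompactSpace G := Manifold.locallyCompact_of_finiteDimensional I
  have hfl : LocallyIntegrable f μ := hf.locallyIntegrable (by norm_num)
  refine ae_eq_zero_of_integral_mul_test_eq_zero (I := I) hfl fun φ hφ ↦ ?_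
  have hφc := hφ.1.continuous
  have hw := contMDiff_mollify hfl hφ.1 hφ.2
  have hw2 : Integrable (fun g ↦ ‖mollify μ f φ g‖ ^ 2) μ := by
    refine ⟨(hw.continuous.norm.pow 2).aestronglyMeasurable, ?_⟩
    simpa [HasFiniteIntegral, enorm_pow] using
      lintegral_enorm_mollify_sq_lt_top hfm hf hφc hφ.2
  have hψc : Continuous fun y ↦ φ y⁻¹ := by fun_prop
  have hψ : HasCompactSupport fun y ↦ φ y⁻¹ := hφ.2.comp_homeomorph (Homeomorph.inv G)
  have hψl : LocallyIntegrable (fun y ↦ φ y⁻¹) μ := hψc.locallyIntegrable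
  have h0 : mollify μ f φ = 0 := by
    refine eq_zero_of_integral_mul_sub_sumOfSquares_eq_zero X hw hw2 fun u hu hu' ↦ ?_
    have hLu := (sumOfSquaresTest X ⟨u, hu, hu'⟩).2
    have hLuc : Continuous (sumOfSquares X u) := hLu.1.continuous
    refine (integral_mollify_mul hfm hfl hφc hφ.2 (hu.continuous.sub hLuc) (hu'.sub hLu.2)).trans ?_
    rw [← hfL _ ⟨contMDiff_leftAverage hψl hu hu', hasCompactSupport_leftAverage hψ hu'⟩]
    congr 1 with g
    rw [sumOfSquares_leftAverage X hψl hu hu']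
    congr 1
    simp only [leftAverage, Pi.sub_apply, mul_sub]
    exact integral_sub (integrable_mul_comp_mul_right hψl hu.continuous hu' g)
      (integrable_mul_comp_mul_right hψl hLuc hLu.2 g)
  simpa [mollify] using congrFun h0 1

end EssentialSelfAdjointnessOfSumOfSquares

end

theorem theoremt10p1
    {E : Type*} [NormedAddCommGroup E] [NormedSpace ℝ E] [FiniteDimensional ℝ E]
    {H : Type*} [TopologicalSpace H] (I : ModelWithCorners ℝ E H) [I.Boundaryless]
    {G : Type*} [TopologicalSpace G] [T2Space G] [SecondCountableTopology G]
    [ChartedSpace H G] [Group G] [LieGroup I ∞ G]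
    [MeasurableSpace G] [BorelSpace G]
    (mu : Measure G) [IsFiniteMeasureOnCompacts mu] [mu.IsOpenPosMeasure]
    [mu.IsMulRightInvariant]
    {k : ℕ} (X : Fin k → GroupLieAlgebra I G) :
    IsEssentiallySelfAdjoint (sumOfSquaresL2 X mu) := by
  have : LocallyCompactSpace G := Manifold.locallyCompact_of_finiteDimensional I
  have hconj (u : smoothCompactlySupported I G) := conj_mem_smoothCompactlySupported u.2
  have hinner (u w : smoothCompactlySupported I G) :
      inner ℂ (testToL2 I mu (sumOfSquaresTest X u)) (testToL2 I mu w) =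
        -∑ j, ∫ g, star (leftInvDeriv (X j) u g) * leftInvDeriv (X j) w g ∂mu := by
    rw [inner_testToL2_testToL2]
    simp only [star_sumOfSquaresTest_apply]
    rw [integral_sumOfSquares_mul X (hconj u).1 (hconj u).2 w.2.1]
    simp only [leftInvDeriv_conj _ u.2.1]
  refine isEssentiallySelfAdjoint_of_nonpos ?_ ?_ ?_ ?_
  · change Dense ((LinearMap.range (testToL2 I mu) : Submodule ℂ (Lp ℂ 2 mu)) : Set (Lp ℂ 2 mu))
    rw [Submodule.dense_iff_topologicalClosure_eq_top, Submodule.topologicalClosure_eq_top_iff,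
      Submodule.eq_bot_iff]
    intro y hy
    have h : (fun g ↦ star (y g)) =ᵐ[mu] 0 := by
      refine ae_eq_zero_of_integral_mul_test_eq_zero (I := I)
        ((Lp.memLp y).star.locallyIntegrable (by norm_num)) fun u hu ↦ ?_
      rw [← inner_testToL2_right y ⟨u, hu⟩]
      exact (Submodule.mem_orthogonal' _ y).1 hy _ ⟨_, rfl⟩
    rw [Lp.eq_zero_iff_ae_eq_zero]
    filter_upwards [h] with g hg using star_eq_zero.1 hg
  · intro x y
    obtain ⟨u, hu, hTu⟩ := exists_sumOfSquaresL2_apply_eq X x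
    obtain ⟨w, hw, hTw⟩ := exists_sumOfSquaresL2_apply_eq X y
    rw [hu, hw, hTu, hTw, hinner, ← inner_conj_symm, hinner, map_neg, map_sum]
    congr 2 with j
    rw [← integral_conj]
    congr 1 with g
    simp [mul_comm]
  · intro x
    obtain ⟨u, hu, hTu⟩ := exists_sumOfSquaresL2_apply_eq X x
    rw [hu, hTu, hinner, Complex.neg_re, Complex.re_sum, neg_nonpos]
    refine Finset.sum_nonneg fun j _ ↦ ?_
    have : ∫ g, star (leftInvDeriv (X j) u g) * leftInvDeriv (X j) u g ∂mu =
        ((∫ g, ‖leftInvDeriv (X j) u g‖ ^ 2 ∂mu : ℝ) : ℂ) := by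
      rw [← integral_complex_ofReal]
      congr 1 with g
      simp [Complex.conj_mul']
    rw [this, Complex.ofReal_re]
    exact integral_nonneg fun g ↦ by positivity
  · intro y hy
    have h : (fun g ↦ star (y g)) =ᵐ[mu] 0 := by
      refine ae_eq_zero_of_integral_mul_sub_sumOfSquares_eq_zero X
        (continuous_star.comp_stronglyMeasurable (Lp.stronglyMeasurable y)) (Lp.memLp y).star
        fun u hu ↦ ?_
      have h1 := hy ⟨testToL2 I mu ⟨u, hu⟩, ⟨_, rfl⟩⟩
      obtain ⟨u', hu', hTu⟩ := exists_sumOfSquaresL2_apply_eq X ⟨testToL2 I mu ⟨u, hu⟩, ⟨_, rfl⟩⟩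
      obtain rfl := testToL2_injective mu hu'
      rw [hTu, ← map_sub, inner_testToL2_right] at h1
      exact h1
    rw [Lp.eq_zero_iff_ae_eq_zero]
    filter_upwards [h] with g hg using star_eq_zero.1 hg
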